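/- Let $\mathcal F^2$ be the Fock space of all entire functions $f$ with $\int_{\mathbb C}|f(z)|^2e^{-|z|^2}\,dV(z)<\infty$, with inner product $\langle f,g\rangle=\frac1\pi\int_{\mathbb C} f(z)\overline{g(z)}e^{-|z|^2}\,dV(z)$. Let $m\ge 0$ be an integer and let $\psi,\varphi,\phi$ be entire functions such that $\psi$ has no zeros and $\phi\not\equiv 0$; if $m\ge 1$, suppose also that $\varphi$ is not constant. Let $S_{\max}$ be the maximal multi-valued weighted composition operator with symbols $(\psi,\varphi,\phi)$, that is, the multi-valued operator with graph $$G(S_{\max})=\{(f,g)\in\mathcal F^2\times\mathcal F^2:\ \psi(z)f(\varphi(z))=\phi(z)g^{(m)}(z)\ \text{ for all } z\in\mathbb C\},$$ and let $S_{\max}^*$ be its adjoint, with graph $$G(S_{\max}^*)=\{(u,v)\in\mathcal F^2\times\mathcal F^2:\ \langle g,u\rangle=\langle f,v\rangle\ \text{ for all }(f,g)\in G(S_{\max})\}.$$ Then the following assertions are equivalent. 1. $S_{\max}$ is hermitian, i.e. $G(S_{\max}^*)=G(S_{\max})$. 2. $G(S_{\max}^*)\subseteq G(S_{\max})$. 3.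 There is an equivalent set of symbols $(\psi_1,\varphi,\phi_1)$, i.e. $\psi_1,\phi_1$ are entire, $\psi_1$ has no zeros and $\phi_1/\psi_1=\phi/\psi$, which has the form $$\varphi(u)=Au+B,\qquad Ce^{u\overline B}\phi_1(u)=\psi_1(u)(Au+B)^m,\qquad u\in\mathbb C,$$ for some $A\in\mathbb R$, $C\in\mathbb R\setminus\{0\}$, $B\in\mathbb C$ (where a $0$-th power is $1$). -/

import Mathlib

open MeasureTheory

/-- The entire functions that are square integrable with respect to the weight `e^{-|z|²}`,
as a complex vector space of functions (`volume` on `ℂ` is the Lebesgue area measure). -/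
def fockSubmodule : Submodule ℂ (ℂ → ℂ) where
  carrier := {f | Differentiable ℂ f ∧
    Integrable (fun z : ℂ => ‖f z‖ ^ 2 * Real.exp (-‖z‖ ^ 2)) volume}
  zero_mem' := by
    refine ⟨differentiable_const (0 : ℂ), ?_⟩
    simp
  add_mem' := by
    rintro f g ⟨hf, hfi⟩ ⟨hg, hgi⟩
    refine ⟨hf.add hg, ?_⟩
    refine Integrable.mono' ((hfi.const_mul 2).add (hgi.const_mul 2)) ?_ ?_
    · have := (hf.add hg).continuous
      exact Continuous.aestronglyMeasurable (by fun_prop)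
    · refine Filter.Eventually.of_forall fun z => ?_
      have h1 : ‖f z + g z‖ ^ 2 ≤ 2 * ‖f z‖ ^ 2 + 2 * ‖g z‖ ^ 2 := by
        have := norm_add_le (f z) (g z)
        nlinarith [norm_nonneg (f z + g z), sq_nonneg (‖f z‖ - ‖g z‖)]
      have h2 := Real.exp_pos (-‖z‖ ^ 2)
      rw [Real.norm_of_nonneg (by positivity)]
      simp only [Pi.add_apply]
      nlinarith
  smul_mem' := by
    rintro c f ⟨hf, hfi⟩
    refine ⟨hf.const_smul c, ?_⟩
    refine (hfi.const_mul (‖c‖ ^ 2)).congr (Filter.Eventually.of_forall fun z => ?_)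
    simp only [Pi.smul_apply, smul_eq_mul, norm_mul]
    ring

/-- The Fock (Segal–Bargmann) space `𝓕²`. It is a type of its own, so that its topology is the
one of the Fock norm and not the topology of pointwise convergence. -/
def FockSpace : Type := fockSubmodule

namespace FockSpace

noncomputable instance : AddCommGroup FockSpace := inferInstanceAs (AddCommGroup fockSubmodule)

noncomputable instance : Module ℂ FockSpace := inferInstanceAs (Module ℂ fockSubmodule)

instance : CoeFun FockSpace (fun _ => ℂ → ℂ) := ⟨fun f => f.1⟩

@[simp] theorem add_apply (f g : FockSpace) (z : ℂ) : (f + g) z = f z + g z := rfl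

@[simp] theorem smul_apply (c : ℂ) (f : FockSpace) (z : ℂ) : (c • f) z = c * f z := rfl

@[simp] theorem zero_apply (z : ℂ) : (0 : FockSpace) z = 0 := rfl

@[ext] theorem ext {f g : FockSpace} (h : ∀ z, f z = g z) : f = g := Subtype.ext (funext h)

theorem differentiable (f : FockSpace) : Differentiable ℂ (f : ℂ → ℂ) := f.2.1

theorem integrable_sq (f : FockSpace) :
    Integrable (fun z : ℂ => ‖f z‖ ^ 2 * Real.exp (-‖z‖ ^ 2)) volume := f.2.2

theorem continuous (f : FockSpace) : Continuous (f : ℂ → ℂ) := f.differentiable.continuous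

theorem integrable_inner (f g : FockSpace) :
    Integrable (fun z : ℂ => g z * (starRingEnd ℂ) (f z) * (Real.exp (-‖z‖ ^ 2) : ℂ)) volume := by
  have hf := f.continuous
  have hg := g.continuous
  refine Integrable.mono' (f.integrable_sq.add g.integrable_sq) ?_ ?_
  · have : Continuous fun z => (starRingEnd ℂ) (f z) := Complex.continuous_conj.comp hf
    exact Continuous.aestronglyMeasurable (by fun_prop)
  · refine Filter.Eventually.of_forall fun z => ?_
    have h2 := Real.exp_pos (-‖z‖ ^ 2)
    rw [norm_mul, norm_mul, RCLike.norm_conj, Complex.norm_real, Real.norm_of_nonneg h2.le]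
    simp only [Pi.add_apply]
    rw [← add_mul]
    refine mul_le_mul_of_nonneg_right ?_ h2.le
    nlinarith [sq_nonneg (‖f z‖ - ‖g z‖), norm_nonneg (f z), norm_nonneg (g z)]

theorem inner_self_eq (f : FockSpace) :
    ((1 / Real.pi : ℝ) : ℂ) *
        ∫ z : ℂ, f z * (starRingEnd ℂ) (f z) * (Real.exp (-‖z‖ ^ 2) : ℂ) =
      ((1 / Real.pi * ∫ z : ℂ, ‖f z‖ ^ 2 * Real.exp (-‖z‖ ^ 2) : ℝ) : ℂ) := by
  rw [Complex.ofReal_mul, ← integral_complex_ofReal]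
  congr 1
  refine integral_congr_ae (Filter.Eventually.of_forall fun z => ?_)
  simp only [Complex.mul_conj, Complex.normSq_eq_norm_sq]
  push_cast
  rfl

/-- The inner product `(1/π) ∫ g(z) conj(f(z)) e^{-|z|²} dV(z)`. Mathlib's `inner ℂ f g` is linear
in its second argument, so this is `⟨g, f⟩` in the convention that is linear in the first one. -/
noncomputable abbrev innerCore : InnerProductSpace.Core ℂ FockSpace where
  inner f g := ((1 / Real.pi : ℝ) : ℂ) *
    ∫ z : ℂ, g z * (starRingEnd ℂ) (f z) * (Real.exp (-‖z‖ ^ 2) : ℂ)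
  conj_inner_symm f g := by
    rw [map_mul, Complex.conj_ofReal, ← integral_conj]
    congr 1
    refine integral_congr_ae (Filter.Eventually.of_forall fun z => ?_)
    simp only [map_mul, Complex.conj_conj, Complex.conj_ofReal]
    ring
  re_inner_nonneg f := by
    rw [inner_self_eq]
    simp only [RCLike.re_to_complex, Complex.ofReal_re]
    have : 0 ≤ ∫ z : ℂ, ‖f z‖ ^ 2 * Real.exp (-‖z‖ ^ 2) :=
      integral_nonneg fun z => by positivity
    positivity
  add_left f g h := by
    rw [← mul_add, ← integral_add (integrable_inner f h) (integrable_inner g h)]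
    congr 1
    refine integral_congr_ae (Filter.Eventually.of_forall fun z => ?_)
    simp only [add_apply, map_add]
    ring
  smul_left f g c := by
    rw [mul_left_comm, ← integral_const_mul ((starRingEnd ℂ) c)]
    congr 1
    refine integral_congr_ae (Filter.Eventually.of_forall fun z => ?_)
    simp only [smul_apply, map_mul]
    ring
  definite f h := by
    rw [inner_self_eq, Complex.ofReal_eq_zero, mul_eq_zero] at h
    have h' := h.resolve_left (by positivity)
    rw [integral_eq_zero_iff_of_nonneg (fun z => by positivity) f.integrable_sq] at h'
    have hf := f.continuous
    have h'' := (Continuous.ae_eq_iff_eq volume (g := fun _ => (0 : ℝ)) (by fun_prop) continuous_const).1 h'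
    ext z
    have hz := congrFun h'' z
    simpa [(Real.exp_pos (-‖z‖ ^ 2)).ne'] using hz

noncomputable instance : NormedAddCommGroup FockSpace := innerCore.toNormedAddCommGroup

noncomputable instance : InnerProductSpace ℂ FockSpace :=
  InnerProductSpace.ofCore innerCore.toCore

theorem inner_def (f g : FockSpace) :
    inner ℂ f g = ((1 / Real.pi : ℝ) : ℂ) *
      ∫ z : ℂ, g z * (starRingEnd ℂ) (f z) * (Real.exp (-‖z‖ ^ 2) : ℂ) := rfl

end FockSpace

/-- The (graph of the) maximal multi-valued weighted composition operator: all pairs `(f, g)` of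
elements of the Fock space with `ψ · (f ∘ φ) = χ · g⁽ᵐ⁾`. A multi-valued linear operator is
represented by its graph, a linear subspace of the product. -/
noncomputable def maxWeightedComp (m : ℕ) (ψ φ χ : ℂ → ℂ) :
    Submodule ℂ (FockSpace × FockSpace) where
  carrier := {p | ∀ z : ℂ, ψ z * p.1 (φ z) = χ z * iteratedDeriv m p.2 z}
  zero_mem' := by
    intro z
    have : ((0 : FockSpace) : ℂ → ℂ) = fun _ => 0 := rfl
    simp [this]
  add_mem' := by
    intro p q hp hq z
    have h : (((p + q).2 : FockSpace) : ℂ → ℂ) = (p.2 : ℂ → ℂ) + (q.2 : ℂ → ℂ) := rfl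
    rw [h, iteratedDeriv_add p.2.differentiable.contDiff.contDiffAt
      q.2.differentiable.contDiff.contDiffAt, Prod.fst_add, FockSpace.add_apply, mul_add, mul_add,
      hp z, hq z]
  smul_mem' := by
    intro c p hp z
    have h : (((c • p).2 : FockSpace) : ℂ → ℂ) = c • (p.2 : ℂ → ℂ) := rfl
    rw [h, iteratedDeriv_const_smul_field, Prod.smul_fst, FockSpace.smul_apply, smul_eq_mul,
      mul_left_comm, hp z, mul_left_comm]

/-- The adjoint of a multi-valued operator, given by its graph `T`: its graph consists of all
`(u, v)` such that `⟨g, u⟩ = ⟨f, v⟩` for every `(f, g)` in `T`. This is `Submodule.adjoint`. -/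
noncomputable def relAdjoint (T : Submodule ℂ (FockSpace × FockSpace)) :
    Submodule ℂ (FockSpace × FockSpace) := T.adjoint

theorem mem_relAdjoint (T : Submodule ℂ (FockSpace × FockSpace)) (u v : FockSpace) :
    (u, v) ∈ relAdjoint T ↔ ∀ f g : FockSpace, (f, g) ∈ T → inner ℂ u g = inner ℂ v f := by
  rw [relAdjoint, Submodule.mem_adjoint_iff]
  refine forall₃_congr fun f g _ => ?_
  rw [sub_eq_zero, ← inner_conj_symm g u, ← inner_conj_symm f v]
  exact (starRingEnd ℂ).injective.eq_iff

/-- A multi-valued operator is hermitian if it has the same graph as its adjoint. -/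
def IsHermitianRel (T : Submodule ℂ (FockSpace × FockSpace)) : Prop := relAdjoint T = T

/-- The triples of entire symbols `(ψ, φ, χ)` and `(ψ₁, φ, χ₁)`, where `ψ` and `ψ₁` have no zeros,
are equivalent if `χ / ψ = χ₁ / ψ₁`. -/
def SymbolsEquivalent (ψ χ ψ₁ χ₁ : ℂ → ℂ) : Prop := ∀ z : ℂ, χ z / ψ z = χ₁ z / ψ₁ z

/-- The symbols `(ψ, φ, χ)` have the form `φ(u) = A u + B` and
`C exp(u conj(B)) χ(u) = ψ(u) (A u + B)ᵐ` with `A` real, `C` real and nonzero, `B` complex. -/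
def HasHermitianForm (m : ℕ) (ψ φ χ : ℂ → ℂ) : Prop :=
  ∃ (A C : ℝ) (B : ℂ), C ≠ 0 ∧ (∀ u : ℂ, φ u = A * u + B) ∧
    ∀ u : ℂ, C * Complex.exp (u * (starRingEnd ℂ) B) * χ u = ψ u * (A * u + B) ^ m

/-! The functions `uᵐ exp (u z̄)` represent `f ↦ f⁽ᵐ⁾(z)`, so pairing the defining equation at `z`
with kernels puts the pair `(conj χ(z) • kernel m z, conj ψ(z) • kernel 0 (φ z))` in the adjoint
(`kernel_mem_relAdjoint`). If the adjoint lies in the operator, these pairs satisfy the defining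
equation. This is an identity in `z` and `w`, and it forces `φ` to be affine with real slope and
determines `χ / ψ` (`hasHermitianForm_of_kernel_identity`).

Conversely, the Hermitian form makes that identity hold, and testing an element of the adjoint
against the kernel pairs puts it in the operator. The hard inclusion is symmetry on the maximal
domain, where convergence of the double integrals is not given. Solved for one component, the
relation reads `f = C wᵐ exp (γ̄ w) g⁽ᵐ⁾(α w + γ)`. Replacing `f` by `exp ((1 - r) γ̄ w) f(r w)`
changes `α` to `α r`, up to a factor `rᵐ`. For small real `r` Fubini gives symmetry; both pairings
are holomorphic in the unit disc after suitable conjugation, so they agree there; then `r → 1⁻`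
(`inner_eq_of_weightedComp`). -/

/-! ### Gaussian integrals and the mean value property -/

theorem pow_mul_exp_le (k : ℕ) (R : ℝ) {δ : ℝ} (hδ : 0 < δ) {x : ℝ} (hx : 0 ≤ x) :
    x ^ k * Real.exp (R * x) ≤
      (k.factorial * Real.exp ((R + 1) ^ 2 / (4 * δ))) * Real.exp (δ * x ^ 2) := by
  have h1 : x ^ k ≤ k.factorial * Real.exp x := by
    have := Real.pow_div_factorial_le_exp x hx k
    rwa [div_le_iff₀ (by positivity), mul_comm] at this
  have h2 : x + R * x ≤ (R + 1) ^ 2 / (4 * δ) + δ * x ^ 2 := by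
    have : (R + 1) ^ 2 / (4 * δ) + δ * x ^ 2 - (x + R * x)
        = (R + 1 - 2 * δ * x) ^ 2 / (4 * δ) := by field_simp; ring
    have h3 : 0 ≤ (R + 1 - 2 * δ * x) ^ 2 / (4 * δ) := by positivity
    linarith
  calc x ^ k * Real.exp (R * x) ≤ k.factorial * Real.exp x * Real.exp (R * x) := by gcongr
    _ = k.factorial * Real.exp (x + R * x) := by rw [Real.exp_add]; ring
    _ ≤ k.factorial * Real.exp ((R + 1) ^ 2 / (4 * δ) + δ * x ^ 2) := by gcongr
    _ = _ := by rw [Real.exp_add]; ring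

theorem integrable_exp_neg_mul_norm_sq {b : ℝ} (hb : 0 < b) :
    Integrable (fun z : ℂ => Real.exp (-b * ‖z‖ ^ 2)) := by
  have h := (GaussianFourier.integrable_cexp_neg_mul_sq_norm_add (V := ℂ) (b := (b : ℂ))
    (by simpa using hb) 0 0).norm
  refine h.congr (Filter.Eventually.of_forall fun z => ?_)
  simp only [Complex.norm_exp]
  congr 1
  simp [← Complex.ofReal_pow]

/-- Half of the decay rate `1 - c` absorbs the power and the linear exponent; the other half stays
integrable. -/
theorem integrable_pow_mul_exp (k : ℕ) (R : ℝ) {c : ℝ} (hc : c < 1) :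
    Integrable (fun z : ℂ => ‖z‖ ^ k * Real.exp (R * ‖z‖ + c * ‖z‖ ^ 2) *
      Real.exp (-‖z‖ ^ 2)) := by
  have hδ : 0 < (1 - c) / 2 := by linarith
  refine Integrable.mono' ((integrable_exp_neg_mul_norm_sq hδ).const_mul
    (k.factorial * Real.exp ((R + 1) ^ 2 / (4 * ((1 - c) / 2))))) (by fun_prop) ?_
  refine Filter.Eventually.of_forall fun z => ?_
  rw [Real.norm_of_nonneg (by positivity)]
  have h := pow_mul_exp_le k R hδ (norm_nonneg z)
  calc _ = ‖z‖ ^ k * Real.exp (R * ‖z‖) * Real.exp ((c - 1) * ‖z‖ ^ 2) := by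
        rw [mul_assoc, mul_assoc, ← Real.exp_add, ← Real.exp_add]; ring_nf
    _ ≤ _ := mul_le_mul_of_nonneg_right h (Real.exp_pos _).le
    _ = _ := by rw [mul_assoc, ← Real.exp_add]; ring_nf

/-- The Gaussian mean value property of entire functions. -/
theorem integral_mul_exp_neg_norm_sq {f : ℂ → ℂ} (hf : Differentiable ℂ f)
    (hi : Integrable (fun z : ℂ => f z * (Real.exp (-‖z‖ ^ 2) : ℂ))) :
    ∫ z : ℂ, f z * (Real.exp (-‖z‖ ^ 2) : ℂ) = Real.pi * f 0 := by
  have hfc := hf.continuous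
  set F : ℂ → ℂ := fun z => f z * (Real.exp (-‖z‖ ^ 2) : ℂ) with hF
  have hFc : Continuous F := by fun_prop
  -- Averaging over rotations preserves the integral and replaces `f` by its circle mean `f 0`.
  let e : ℝ → (ℂ ≃ₗᵢ[ℝ] ℂ) := fun θ => rotation (Circle.exp θ)
  have he : ∀ θ z, e θ z = Complex.exp (θ * Complex.I) * z := fun θ z => by
    simp [e, Circle.coe_exp]
  have hrot : ∀ θ, ∫ z, F (e θ z) = ∫ z, F z := fun θ =>
    (e θ).measurePreserving.integral_comp (e θ).toHomeomorph.measurableEmbedding F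
  have hroti : ∀ θ, Integrable (fun z => F (e θ z)) := fun θ =>
    ((e θ).measurePreserving.integrable_comp_emb (e θ).toHomeomorph.measurableEmbedding).2 hi
  have hrotn : ∀ θ, ∫ z, ‖F (e θ z)‖ = ∫ z, ‖F z‖ := fun θ =>
    (e θ).measurePreserving.integral_comp (e θ).toHomeomorph.measurableEmbedding (fun z => ‖F z‖)
  have hec : Continuous fun p : ℝ × ℂ => F (e p.1 p.2) := by
    simp only [he]; fun_prop
  have hprod : Integrable (fun p : ℝ × ℂ => F (e p.1 p.2))
      ((volume.restrict (Set.Ioc 0 (2 * Real.pi))).prod volume) := by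
    rw [integrable_prod_iff hec.aestronglyMeasurable]
    refine ⟨Filter.Eventually.of_forall hroti, ?_⟩
    simp only [hrotn]
    exact integrable_const _
  have hswap := integral_integral_swap (f := fun θ z => F (e θ z)) hprod
  have hpi := Real.pi_pos
  have hcirc : ∀ z, ∫ θ in Set.Ioc 0 (2 * Real.pi), f (e θ z) = 2 * Real.pi * f 0 := by
    intro z
    have hd : DiffContOnCl ℂ (fun ζ => f (ζ * z)) (Metric.ball 0 |1|) :=
      (hf.comp (differentiable_id.mul_const z)).diffContOnCl
    have := hd.circleAverage
    rw [Real.circleAverage, intervalIntegral.integral_of_le (by positivity)] at this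
    simp only [circleMap, zero_add, Complex.ofReal_one, one_mul, zero_mul] at this
    have h2π : (2 * Real.pi : ℂ) ≠ 0 := by exact_mod_cast (by positivity : 2 * Real.pi ≠ 0)
    simp only [he]
    rw [← this, Complex.real_smul, Complex.ofReal_inv, ← mul_assoc]
    push_cast
    rw [mul_inv_cancel₀ h2π, one_mul]
  simp only [hrot] at hswap
  have h2 : ∀ z, ∫ θ in Set.Ioc 0 (2 * Real.pi), F (e θ z) =
      2 * Real.pi * f 0 * (Real.exp (-‖z‖ ^ 2) : ℂ) := by
    intro z
    rw [← hcirc z, ← integral_mul_const]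
    simp only [hF, LinearIsometryEquiv.norm_map]
  simp only [h2] at hswap
  rw [integral_const_mul, integral_complex_ofReal] at hswap
  have hg : ∫ z : ℂ, Real.exp (-‖z‖ ^ 2) = Real.pi := by
    have := GaussianFourier.integral_rexp_neg_mul_sq_norm (V := ℂ) (b := 1) one_pos
    simpa using this
  rw [hg, setIntegral_const] at hswap
  simp only [Real.volume_real_Ioc_of_le (show (0:ℝ) ≤ 2 * Real.pi by positivity), sub_zero,
    Complex.real_smul] at hswap
  have h3 : ((2 * Real.pi : ℝ) : ℂ) ≠ 0 := by exact_mod_cast (by positivity : 2 * Real.pi ≠ 0)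
  refine mul_left_cancel₀ h3 (hswap.trans ?_)
  push_cast
  ring

/-! ### Reproducing kernels for point values and derivatives -/

namespace FockSpace

open ComplexConjugate

/-- The product is dominated by a sum of squares; squaring doubles the Gaussian exponent, hence the
threshold `1 / 2`. -/
theorem integrable_norm_mul (f : FockSpace) (k : ℕ) (R : ℝ) {c : ℝ} (hc : c < 1 / 2) :
    Integrable (fun w : ℂ => ‖f w‖ * (‖w‖ ^ k * Real.exp (R * ‖w‖ + c * ‖w‖ ^ 2)) *
      Real.exp (-‖w‖ ^ 2)) := by
  have hf := f.continuous
  refine Integrable.mono' (f.integrable_sq.add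
    (integrable_pow_mul_exp (2 * k) (2 * R) (c := 2 * c) (by linarith))) (by fun_prop) ?_
  refine Filter.Eventually.of_forall fun w => ?_
  rw [Real.norm_of_nonneg (by positivity)]
  set E := ‖w‖ ^ k * Real.exp (R * ‖w‖ + c * ‖w‖ ^ 2) with hE
  have hE2 : ‖w‖ ^ (2 * k) * Real.exp (2 * R * ‖w‖ + 2 * c * ‖w‖ ^ 2) = E ^ 2 := by
    rw [hE, mul_pow, ← pow_mul, mul_comm k 2, ← Real.exp_nat_mul]
    congr 2
    push_cast
    ring
  simp only [Pi.add_apply, hE2, ← add_mul]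
  refine mul_le_mul_of_nonneg_right ?_ (Real.exp_pos _).le
  have : 0 ≤ E := by positivity
  nlinarith [sq_nonneg (‖f w‖ - E), norm_nonneg (f w)]

/-- The function `u ↦ uᵐ exp (u conj(a))`, which represents `f ↦ f⁽ᵐ⁾(a)`. -/
noncomputable def kernel (m : ℕ) (a : ℂ) : FockSpace :=
  ⟨fun u => u ^ m * Complex.exp (u * conj a), by fun_prop, by
    refine Integrable.mono' (integrable_pow_mul_exp (2 * m) (2 * ‖a‖) (c := 0) one_pos)
      (Continuous.aestronglyMeasurable (by fun_prop)) (Filter.Eventually.of_forall fun u => ?_)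
    rw [Real.norm_of_nonneg (by positivity)]
    refine mul_le_mul_of_nonneg_right ?_ (Real.exp_pos _).le
    rw [norm_mul, mul_pow, norm_pow, ← pow_mul, mul_comm m 2, Complex.norm_exp, ← Real.exp_nat_mul]
    gcongr
    have : (u * conj a).re ≤ ‖u‖ * ‖a‖ := by
      simpa using Complex.re_le_norm (u * conj a)
    push_cast
    linarith⟩

theorem kernel_apply (m : ℕ) (a u : ℂ) : kernel m a u = u ^ m * Complex.exp (u * conj a) := rfl

theorem exp_neg_norm_sq (z : ℂ) :
    (Real.exp (-‖z‖ ^ 2) : ℂ) = Complex.exp (-(z * conj z)) := by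
  rw [Complex.mul_conj', Complex.ofReal_exp]
  push_cast
  rfl

theorem pi_inv_mul {x : ℂ} : ((1 / Real.pi : ℝ) : ℂ) * (Real.pi * x) = x := by
  have : (Real.pi : ℂ) ≠ 0 := by exact_mod_cast Real.pi_ne_zero
  push_cast
  field_simp

/-- Translation by `z` turns the integrand into `f(w + z) exp (-w z̄)` against the centred Gaussian,
and the mean value property evaluates it at `w = 0`. -/
theorem inner_kernel_zero (f : FockSpace) (z : ℂ) : inner ℂ (kernel 0 z) f = f z := by
  rw [inner_def]
  have hi := integrable_inner (kernel 0 z) f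
  rw [← integral_add_right_eq_self _ z]
  have hi' := hi.comp_add_right z
  have key : ∀ w, f (w + z) * conj (kernel 0 z (w + z)) * (Real.exp (-‖w + z‖ ^ 2) : ℂ) =
      (f (w + z) * Complex.exp (-(w * conj z))) * (Real.exp (-‖w‖ ^ 2) : ℂ) := by
    intro w
    rw [exp_neg_norm_sq, exp_neg_norm_sq, kernel_apply, pow_zero, one_mul, ← Complex.exp_conj,
      mul_assoc, mul_assoc, ← Complex.exp_add, ← Complex.exp_add]
    congr 2
    simp only [map_mul, map_add, Complex.conj_conj]
    ring
  simp only [key] at hi' ⊢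
  rw [integral_mul_exp_neg_norm_sq (f := fun w => f (w + z) * Complex.exp (-(w * conj z)))
    ((f.differentiable.comp (differentiable_id.add_const z)).mul (by fun_prop)) hi', pi_inv_mul]
  simp

/-- The conjugated kernel is holomorphic in `a`, and differentiating it produces one more factor
`w̄`. -/
theorem hasDerivAt_inner_kernel (f : FockSpace) (m : ℕ) (z : ℂ) :
    HasDerivAt (fun a => (inner ℂ (kernel m a) f : ℂ)) (inner ℂ (kernel (m + 1) z) f) z := by
  simp only [inner_def]
  have hc : ∀ n a w, conj (kernel n a w) = conj w ^ n * Complex.exp (conj w * a) := fun n a w => by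
    rw [kernel_apply, map_mul, map_pow, ← Complex.exp_conj, map_mul, Complex.conj_conj]
  refine HasDerivAt.const_mul _ ?_
  refine (hasDerivAt_integral_of_dominated_loc_of_deriv_le
    (F := fun a w => f w * conj (kernel m a w) * (Real.exp (-‖w‖ ^ 2) : ℂ))
    (F' := fun a w => f w * conj (kernel (m + 1) a w) * (Real.exp (-‖w‖ ^ 2) : ℂ))
    (Metric.ball_mem_nhds z one_pos) (Filter.Eventually.of_forall fun a =>
      (integrable_inner _ _).aestronglyMeasurable) (integrable_inner _ _)
    (integrable_inner _ _).aestronglyMeasurable (Filter.Eventually.of_forall fun w a ha => ?_)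
    (f.integrable_norm_mul (m + 1) (‖z‖ + 1) (c := 0) (by norm_num))
    (Filter.Eventually.of_forall fun w a _ => ?_)).2
  · rw [norm_mul, norm_mul, Complex.norm_real, Real.norm_of_nonneg (Real.exp_pos _).le, hc,
      norm_mul, norm_pow, RCLike.norm_conj, Complex.norm_exp]
    gcongr
    have h1 : (conj w * a).re ≤ ‖w‖ * ‖a‖ := by simpa using Complex.re_le_norm (conj w * a)
    have h2 : ‖a‖ ≤ ‖z‖ + 1 := by
      have := norm_sub_norm_le a z
      rw [Metric.mem_ball, dist_eq_norm] at ha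
      linarith
    nlinarith [norm_nonneg w]
  · simp only [hc]
    have h : HasDerivAt (fun a => Complex.exp (conj w * a))
        (Complex.exp (conj w * a) * (conj w * 1)) a :=
      ((hasDerivAt_id a).const_mul (conj w)).cexp
    refine (((h.const_mul (conj w ^ m)).const_mul (f w)).mul_const
      (Real.exp (-‖w‖ ^ 2) : ℂ)).congr_deriv ?_
    ring

theorem inner_kernel (f : FockSpace) (m : ℕ) (z : ℂ) :
    inner ℂ (kernel m z) f = iteratedDeriv m f z := by
  induction m generalizing z with
  | zero => rw [inner_kernel_zero, iteratedDeriv_zero]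
  | succ m ih =>
    rw [iteratedDeriv_succ, ← funext ih]
    exact (hasDerivAt_inner_kernel f m z).deriv.symm

theorem norm_apply_le (f : FockSpace) (z : ℂ) : ‖f z‖ ≤ ‖f‖ * Real.exp (‖z‖ ^ 2 / 2) := by
  have hk : ‖kernel 0 z‖ = Real.exp (‖z‖ ^ 2 / 2) := by
    have h : (inner ℂ (kernel 0 z) (kernel 0 z) : ℂ) = (Real.exp (‖z‖ ^ 2) : ℂ) := by
      rw [inner_kernel_zero, kernel_apply, pow_zero, one_mul, Complex.mul_conj']
      push_cast
      rfl
    rw [inner_self_eq_norm_sq_to_K] at h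
    have h' : ‖kernel 0 z‖ ^ 2 = Real.exp (‖z‖ ^ 2 / 2) ^ 2 := by
      rw [← Real.exp_nat_mul]
      push_cast
      rw [mul_div_cancel₀ _ two_ne_zero]
      exact Complex.ofReal_injective (by rw [Complex.ofReal_pow]; exact h)
    exact (sq_eq_sq₀ (norm_nonneg _) (Real.exp_pos _).le).1 h'
  rw [← inner_kernel_zero f z, mul_comm, ← hk]
  exact norm_inner_le_norm _ _

end FockSpace

/-- Holomorphy of an integral with a holomorphic parameter. -/
theorem differentiableOn_integral_of_locally_bounded {U : Set ℂ} {F : ℂ → ℂ → ℂ}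
    (hF : Continuous fun p : ℂ × ℂ => F p.1 p.2) (hd : ∀ w, Differentiable ℂ fun r => F r w)
    (hb : ∀ r₀ ∈ U, ∃ ρ > 0, ∃ bound : ℂ → ℝ, Integrable bound ∧
      ∀ r ∈ Metric.ball r₀ ρ, ∀ w, ‖F r w‖ ≤ bound w) :
    DifferentiableOn ℂ (fun r => ∫ w, F r w) U := by
  intro r₀ hr₀
  obtain ⟨ρ, hρ, bound, hbi, hbound⟩ := hb r₀ hr₀
  have hFr : ∀ r, Continuous (F r) := fun r => hF.comp (by fun_prop : Continuous fun w => (r, w))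
  have hF' : Measurable fun w => deriv (fun r => F r w) r₀ :=
    (measurable_deriv_with_param (f := fun w r => F r w)
      (hF.comp continuous_swap)).comp (by fun_prop : Measurable fun w : ℂ => (w, r₀))
  refine (hasDerivAt_integral_of_dominated_loc_of_deriv_le
    (F' := fun r w => deriv (fun r => F r w) r) (bound := fun w => bound w / (ρ / 2))
    (Metric.ball_mem_nhds r₀ (half_pos hρ))
    (Filter.Eventually.of_forall fun r => (hFr r).aestronglyMeasurable)
    (hbi.mono' (hFr r₀).aestronglyMeasurable
      (Filter.Eventually.of_forall (hbound r₀ (Metric.mem_ball_self hρ))))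
    hF'.aestronglyMeasurable (Filter.Eventually.of_forall fun w r hr => ?_)
    (hbi.div_const _) (Filter.Eventually.of_forall fun w r _ =>
      (hd w r).hasDerivAt)).2.differentiableAt.differentiableWithinAt
  -- Cauchy's estimate on circles of radius `ρ / 2`, which stay in the ball of radius `ρ`, so
  -- dominating `F` alone suffices.
  refine Complex.norm_deriv_le_of_forall_mem_sphere_norm_le (half_pos hρ)
    (hd w).diffContOnCl fun s hs => hbound s ?_ w
  rw [Metric.mem_ball] at hr ⊢
  rw [Metric.mem_sphere] at hs
  linarith [dist_triangle s r r₀]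

/-! ### Dilated pairings and symmetry for contractive dilations -/

namespace FockSpace

open ComplexConjugate

/-- The integrand of the pairing of `w ↦ exp ((1 - r) γ̄ w) f (r w)` with `q`. -/
noncomputable def dilationIntegrand (γ : ℂ) (f q : FockSpace) (r w : ℂ) : ℂ :=
  Complex.exp (conj γ * (1 - r) * w) * f (r * w) * conj (q w) * (Real.exp (-‖w‖ ^ 2) : ℂ)

/-- The pairing of `w ↦ exp ((1 - r) γ̄ w) f (r w)` with `q`, without the factor `1 / π`. -/
noncomputable def dilationPairing (γ : ℂ) (f q : FockSpace) (r : ℂ) : ℂ :=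
  ∫ w, dilationIntegrand γ f q r w

theorem continuous_dilationIntegrand (γ : ℂ) (f q : FockSpace) :
    Continuous fun p : ℂ × ℂ => dilationIntegrand γ f q p.1 p.2 := by
  have hf := f.continuous
  have hq := q.continuous
  have hconj : Continuous fun w : ℂ => conj w := Complex.continuous_conj
  unfold dilationIntegrand
  fun_prop

theorem norm_dilationIntegrand_le (γ : ℂ) (f q : FockSpace) {r : ℂ} {ρ : ℝ} (hr : ‖r‖ ≤ ρ) (w : ℂ) :
    ‖dilationIntegrand γ f q r w‖ ≤ ‖f‖ * (‖q w‖ * (‖w‖ ^ 0 *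
      Real.exp (‖γ‖ * (1 + ρ) * ‖w‖ + ρ ^ 2 / 2 * ‖w‖ ^ 2)) * Real.exp (-‖w‖ ^ 2)) := by
  have h1 := f.norm_apply_le (r * w)
  have h2 : (conj γ * (1 - r) * w).re ≤ ‖γ‖ * (1 + ρ) * ‖w‖ := by
    refine (Complex.re_le_norm _).trans ?_
    rw [norm_mul, norm_mul, RCLike.norm_conj]
    gcongr
    refine (norm_sub_le _ _).trans ?_
    rw [norm_one]
    linarith
  have h3 : ‖r * w‖ ^ 2 / 2 ≤ ρ ^ 2 / 2 * ‖w‖ ^ 2 := by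
    rw [norm_mul, mul_pow, mul_div_right_comm]
    gcongr
  rw [dilationIntegrand, norm_mul, norm_mul, norm_mul, Complex.norm_real,
    Real.norm_of_nonneg (Real.exp_pos _).le, RCLike.norm_conj, Complex.norm_exp]
  calc _ ≤ Real.exp (‖γ‖ * (1 + ρ) * ‖w‖) * (‖f‖ * Real.exp (ρ ^ 2 / 2 * ‖w‖ ^ 2)) * ‖q w‖ *
        Real.exp (-‖w‖ ^ 2) := by
        gcongr
        exact h1.trans (by gcongr)
    _ = _ := by rw [Real.exp_add]; ring

theorem differentiableOn_dilationPairing (γ : ℂ) (f q : FockSpace) :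
    DifferentiableOn ℂ (dilationPairing γ f q) (Metric.ball 0 1) := by
  refine differentiableOn_integral_of_locally_bounded (continuous_dilationIntegrand γ f q)
    (fun w => ?_) fun r₀ hr₀ => ?_
  · have hf := f.differentiable
    unfold dilationIntegrand
    fun_prop
  · rw [mem_ball_zero_iff] at hr₀
    -- On this ball `‖r‖ ≤ (1 + ‖r₀‖) / 2 < 1`, which keeps the Gaussian exponent below `1 / 2`.
    refine ⟨(1 - ‖r₀‖) / 2, by linarith, _, (q.integrable_norm_mul 0 (‖γ‖ * (1 + (1 + ‖r₀‖) / 2))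
      (c := ((1 + ‖r₀‖) / 2) ^ 2 / 2) (by nlinarith [norm_nonneg r₀])).const_mul ‖f‖,
      fun r hr w => norm_dilationIntegrand_le γ f q ?_ w⟩
    rw [Metric.mem_ball, dist_eq_norm] at hr
    linarith [norm_sub_norm_le r r₀]

theorem integrable_dilationIntegrand (γ : ℂ) (f q : FockSpace) {r : ℂ} (hr : ‖r‖ < 1) :
    Integrable (dilationIntegrand γ f q r) := by
  refine Integrable.mono' ((q.integrable_norm_mul 0 (‖γ‖ * (1 + ‖r‖))
    (c := ‖r‖ ^ 2 / 2) (by nlinarith [norm_nonneg r])).const_mul ‖f‖) ?_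
    (Filter.Eventually.of_forall fun w => norm_dilationIntegrand_le γ f q le_rfl w)
  exact ((continuous_dilationIntegrand γ f q).comp
    (by fun_prop : Continuous fun w => (r, w))).aestronglyMeasurable

/-- The operator `g ↦ wᵐ exp (γ̄ w) g⁽ᵐ⁾(ε w + γ)` is symmetric if `ε` is real and `|ε| < 1`. -/
theorem integral_weightedComp_symm (m : ℕ) (γ : ℂ) {ε : ℝ} (hε : |ε| < 1) (g q : FockSpace) :
    ∫ w, w ^ m * Complex.exp (conj γ * w) * iteratedDeriv m g (ε * w + γ) * conj (q w) *
        (Real.exp (-‖w‖ ^ 2) : ℂ) =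
      ∫ w, conj (w ^ m * Complex.exp (conj γ * w) * iteratedDeriv m q (ε * w + γ) * conj (g w)) *
        (Real.exp (-‖w‖ ^ 2) : ℂ) := by
  -- The reproducing formula writes both sides as double integrals of `Φ`. Its coupling factor is at
  -- most `exp (|ε| (‖w‖² + ‖ζ‖²) / 2)`, so `|ε| < 1` is what Fubini needs.
  let Φ : ℂ → ℂ → ℂ := fun w ζ =>
    (conj (q w) * (w ^ m * Complex.exp (conj γ * w)) * (Real.exp (-‖w‖ ^ 2) : ℂ)) *
    (g ζ * (conj ζ ^ m * Complex.exp (γ * conj ζ)) * (Real.exp (-‖ζ‖ ^ 2) : ℂ)) *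
    Complex.exp (ε * (w * conj ζ))
  have hg := g.continuous
  have hq := q.continuous
  have hconj : Continuous fun w : ℂ => conj w := Complex.continuous_conj
  have hΦ : Integrable (fun p : ℂ × ℂ => Φ p.1 p.2) (volume.prod volume) := by
    have hb := fun f : FockSpace => f.integrable_norm_mul m ‖γ‖ (c := |ε| / 2) (by linarith)
    refine Integrable.mono' ((hb q).mul_prod (hb g))
      (Continuous.aestronglyMeasurable (by fun_prop)) (Filter.Eventually.of_forall fun p => ?_)
    obtain ⟨w, ζ⟩ := p
    have h1 : (conj γ * w).re ≤ ‖γ‖ * ‖w‖ := by simpa using Complex.re_le_norm (conj γ * w)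
    have h2 : (γ * conj ζ).re ≤ ‖γ‖ * ‖ζ‖ := by simpa using Complex.re_le_norm (γ * conj ζ)
    have h3 : (ε * (w * conj ζ)).re ≤ |ε| / 2 * ‖w‖ ^ 2 + |ε| / 2 * ‖ζ‖ ^ 2 := by
      have : (ε * (w * conj ζ)).re ≤ |ε| * (‖w‖ * ‖ζ‖) := by
        simpa using Complex.re_le_norm (ε * (w * conj ζ))
      nlinarith [mul_nonneg (abs_nonneg ε) (sq_nonneg (‖w‖ - ‖ζ‖))]
    simp only [Φ, norm_mul, norm_pow, RCLike.norm_conj, Complex.norm_exp, Complex.norm_real,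
      Real.norm_of_nonneg (Real.exp_pos _).le]
    calc _ ≤ (‖q w‖ * (‖w‖ ^ m * Real.exp (‖γ‖ * ‖w‖)) * Real.exp (-‖w‖ ^ 2)) *
          (‖g ζ‖ * (‖ζ‖ ^ m * Real.exp (‖γ‖ * ‖ζ‖)) * Real.exp (-‖ζ‖ ^ 2)) *
          Real.exp (|ε| / 2 * ‖w‖ ^ 2 + |ε| / 2 * ‖ζ‖ ^ 2) := by gcongr
      _ = _ := by simp only [Real.exp_add]; ring
  have hderiv : ∀ (f : FockSpace) a, iteratedDeriv m f a = ((1 / Real.pi : ℝ) : ℂ) *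
      ∫ ζ, f ζ * (conj ζ ^ m * Complex.exp (a * conj ζ)) * (Real.exp (-‖ζ‖ ^ 2) : ℂ) := by
    intro f a
    rw [← inner_kernel, inner_def]
    simp only [kernel_apply, map_mul, map_pow, ← Complex.exp_conj, Complex.conj_conj, mul_comm a]
  have hl : ∀ w, w ^ m * Complex.exp (conj γ * w) * iteratedDeriv m g (ε * w + γ) * conj (q w) *
      (Real.exp (-‖w‖ ^ 2) : ℂ) = ((1 / Real.pi : ℝ) : ℂ) * ∫ ζ, Φ w ζ := by
    intro w
    rw [hderiv]
    have : ∀ ζ, Φ w ζ = (conj (q w) * (w ^ m * Complex.exp (conj γ * w)) *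
        (Real.exp (-‖w‖ ^ 2) : ℂ)) * (g ζ * (conj ζ ^ m * Complex.exp ((ε * w + γ) * conj ζ)) *
          (Real.exp (-‖ζ‖ ^ 2) : ℂ)) := by
      intro ζ
      simp only [Φ, add_mul, Complex.exp_add, mul_assoc (ε : ℂ)]
      ring
    simp only [this]
    rw [integral_const_mul]
    ring
  have hr : ∀ ζ, conj (ζ ^ m * Complex.exp (conj γ * ζ) * iteratedDeriv m q (ε * ζ + γ) *
      conj (g ζ)) * (Real.exp (-‖ζ‖ ^ 2) : ℂ) = ((1 / Real.pi : ℝ) : ℂ) * ∫ w, Φ w ζ := by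
    intro ζ
    rw [hderiv]
    have : ∀ w, Φ w ζ = (g ζ * (conj ζ ^ m * Complex.exp (γ * conj ζ)) *
        (Real.exp (-‖ζ‖ ^ 2) : ℂ)) *
        conj (q w * (conj w ^ m * Complex.exp ((ε * ζ + γ) * conj w)) *
          (Real.exp (-‖w‖ ^ 2) : ℂ)) := by
      intro w
      have : conj (Complex.exp ((ε * ζ + γ) * conj w)) =
          Complex.exp (conj γ * w + ε * (w * conj ζ)) := by
        rw [← Complex.exp_conj]
        congr 1
        simp only [map_mul, map_add, Complex.conj_conj, Complex.conj_ofReal]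
        ring
      simp only [Φ, map_mul, map_pow, this, Complex.conj_conj, Complex.conj_ofReal,
        Complex.exp_add]
      ring
    simp only [this]
    rw [integral_const_mul, integral_conj]
    simp only [map_mul, map_pow, Complex.conj_conj, Complex.conj_ofReal, ← Complex.exp_conj]
    ring
  simp only [hl, hr, integral_const_mul]
  rw [integral_integral_swap hΦ]

end FockSpace

/-! ### The limit `r → 1` and symmetry on the maximal domain -/

namespace FockSpace

open ComplexConjugate Filter Topology

/-- The exponential factor is paid for by the gap between the two Gaussians: `2 (1 - r) ‖γ‖ ‖w‖ ≤ (1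
- r) (‖γ‖² + ‖w‖²)` and `1 - r ≤ 1 - r²`. -/
theorem norm_sq_dilation_le (γ : ℂ) (f : FockSpace) {r : ℝ} (h0 : 0 ≤ r) (h1 : r ≤ 1) (w : ℂ) :
    ‖Complex.exp (conj γ * (1 - r) * w) * f (r * w)‖ ^ 2 * Real.exp (-‖w‖ ^ 2) ≤
      Real.exp (‖γ‖ ^ 2) * (‖f (r • w)‖ ^ 2 * Real.exp (-‖r • w‖ ^ 2)) := by
  have h2 : (conj γ * (1 - r) * w).re ≤ ‖γ‖ * (1 - r) * ‖w‖ := by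
    refine (Complex.re_le_norm _).trans (le_of_eq ?_)
    rw [norm_mul, norm_mul, RCLike.norm_conj, ← Complex.ofReal_one, ← Complex.ofReal_sub,
      Complex.norm_real, Real.norm_of_nonneg (by linarith)]
  have h3 : Real.exp (2 * (conj γ * (1 - r) * w).re) * Real.exp (-‖w‖ ^ 2) ≤
      Real.exp (‖γ‖ ^ 2) * Real.exp (-‖r • w‖ ^ 2) := by
    rw [← Real.exp_add, ← Real.exp_add, norm_smul, mul_pow, Real.norm_of_nonneg h0]
    refine Real.exp_le_exp.2 ?_
    nlinarith [mul_nonneg (sub_nonneg.2 h1) (sq_nonneg (‖γ‖ - ‖w‖)),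
      mul_nonneg h0 (sq_nonneg ‖γ‖), mul_nonneg (mul_nonneg h0 (sub_nonneg.2 h1)) (sq_nonneg ‖w‖)]
  rw [norm_mul, mul_pow, Complex.norm_exp, ← Real.exp_nat_mul, Complex.real_smul]
  rw [Complex.real_smul] at h3
  push_cast
  calc _ = ‖f (r * w)‖ ^ 2 * (Real.exp (2 * (conj γ * (1 - r) * w).re) * Real.exp (-‖w‖ ^ 2)) := by
        ring
    _ ≤ ‖f (r * w)‖ ^ 2 * (Real.exp (‖γ‖ ^ 2) * Real.exp (-‖r * w‖ ^ 2)) := by gcongr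
    _ = _ := by ring

theorem norm_dilationIntegrand_le_add (γ : ℂ) (f q : FockSpace) {r : ℝ} (h0 : 0 ≤ r) (h1 : r ≤ 1)
    {δ : ℝ} (hδ : 0 < δ) (w : ℂ) :
    ‖dilationIntegrand γ f q r w‖ ≤
      δ * Real.exp (‖γ‖ ^ 2) * (‖f (r • w)‖ ^ 2 * Real.exp (-‖r • w‖ ^ 2)) +
        δ⁻¹ * (‖q w‖ ^ 2 * Real.exp (-‖w‖ ^ 2)) := by
  have h := mul_le_mul_of_nonneg_left (norm_sq_dilation_le γ f h0 h1 w) hδ.le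
  rw [dilationIntegrand, norm_mul, norm_mul _ (conj (q w)), Complex.norm_real, RCLike.norm_conj,
    Real.norm_of_nonneg (Real.exp_pos _).le]
  set D := ‖Complex.exp (conj γ * (1 - r) * w) * f (r * w)‖
  have h2 : D * ‖q w‖ ≤ δ * D ^ 2 + δ⁻¹ * ‖q w‖ ^ 2 := by
    have : δ * D ^ 2 + δ⁻¹ * ‖q w‖ ^ 2 - D * ‖q w‖ =
        δ⁻¹ * ((δ * D - ‖q w‖ / 2) ^ 2 + 3 / 4 * ‖q w‖ ^ 2) := by
      field_simp
      ring
    have : 0 ≤ δ⁻¹ * ((δ * D - ‖q w‖ / 2) ^ 2 + 3 / 4 * ‖q w‖ ^ 2) := by positivity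
    linarith
  calc _ ≤ (δ * D ^ 2 + δ⁻¹ * ‖q w‖ ^ 2) * Real.exp (-‖w‖ ^ 2) := by gcongr
    _ = δ * (D ^ 2 * Real.exp (-‖w‖ ^ 2)) + δ⁻¹ * (‖q w‖ ^ 2 * Real.exp (-‖w‖ ^ 2)) := by ring
    _ ≤ _ := by linarith

theorem dilationIntegrand_one (γ : ℂ) (f q : FockSpace) (w : ℂ) :
    dilationIntegrand γ f q 1 w = f w * conj (q w) * (Real.exp (-‖w‖ ^ 2) : ℂ) := by
  simp [dilationIntegrand]

theorem integrable_dilationIntegrand_ofReal (γ : ℂ) (f q : FockSpace) {r : ℝ} (h0 : 0 ≤ r)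
    (h1 : r ≤ 1) : Integrable (dilationIntegrand γ f q r) := by
  rcases h1.lt_or_eq with h | rfl
  · exact integrable_dilationIntegrand γ f q (by
      rwa [Complex.norm_real, Real.norm_of_nonneg h0])
  · rw [Complex.ofReal_one, funext (dilationIntegrand_one γ f q)]
    exact integrable_inner q f

/-- The bound does not involve `r`: scaling the plane costs `r⁻² ≤ 4`. A small `δ` controls the
first term, a tail set `s` the second. -/
theorem norm_setIntegral_dilationIntegrand_le (γ : ℂ) (f q : FockSpace) {r : ℝ}
    (h0 : 1 / 2 ≤ r) (h1 : r ≤ 1) {δ : ℝ} (hδ : 0 < δ) (s : Set ℂ) :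
    ‖∫ w in s, dilationIntegrand γ f q r w‖ ≤
      δ * (4 * Real.exp (‖γ‖ ^ 2) * ∫ z, ‖f z‖ ^ 2 * Real.exp (-‖z‖ ^ 2)) +
        δ⁻¹ * ∫ w in s, ‖q w‖ ^ 2 * Real.exp (-‖w‖ ^ 2) := by
  have hr : 0 < r := by linarith
  have hi : Integrable fun w : ℂ => ‖f (r • w)‖ ^ 2 * Real.exp (-‖r • w‖ ^ 2) :=
    (integrable_comp_smul_iff volume (fun w : ℂ => ‖f w‖ ^ 2 * Real.exp (-‖w‖ ^ 2)) hr.ne').2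
      f.integrable_sq
  have hnn : 0 ≤ ∫ z, ‖f z‖ ^ 2 * Real.exp (-‖z‖ ^ 2) := integral_nonneg fun z => by positivity
  have hscale : ∫ w in s, ‖f (r • w)‖ ^ 2 * Real.exp (-‖r • w‖ ^ 2) ≤
      4 * ∫ z, ‖f z‖ ^ 2 * Real.exp (-‖z‖ ^ 2) := by
    refine (setIntegral_le_integral hi (Eventually.of_forall fun w => by positivity)).trans ?_
    rw [Measure.integral_comp_smul volume (fun w : ℂ => ‖f w‖ ^ 2 * Real.exp (-‖w‖ ^ 2)) r,
      Complex.finrank_real_complex, smul_eq_mul]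
    refine mul_le_mul_of_nonneg_right ?_ hnn
    rw [abs_of_pos (by positivity), inv_le_comm₀ (by positivity) (by norm_num)]
    nlinarith
  refine (norm_integral_le_integral_norm _).trans ?_
  refine (integral_mono (integrable_dilationIntegrand_ofReal γ f q hr.le h1).norm.restrict
    ((hi.const_mul _).add (q.integrable_sq.const_mul _)).restrict
    (norm_dilationIntegrand_le_add γ f q hr.le h1 hδ)).trans ?_
  simp only [Pi.add_apply]
  rw [integral_add (hi.const_mul _).restrict (q.integrable_sq.const_mul _).restrict,
    integral_const_mul, integral_const_mul]
  have := mul_le_mul_of_nonneg_left hscale (by positivity : 0 ≤ δ * Real.exp (‖γ‖ ^ 2))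
  linarith

theorem tendsto_setIntegral_dilationIntegrand (γ : ℂ) (f q : FockSpace) (N : ℝ) :
    Tendsto (fun r : ℝ => ∫ w in Metric.closedBall 0 N, dilationIntegrand γ f q r w) (𝓝[<] 1)
      (𝓝 (∫ w in Metric.closedBall 0 N, dilationIntegrand γ f q (1 : ℝ) w)) := by
  refine tendsto_nhdsWithin_of_tendsto_nhds (Continuous.tendsto ?_ 1)
  have hc : Continuous (fun (r : ℝ) w => dilationIntegrand γ f q r w).uncurry :=
    Continuous.comp (g := fun p : ℂ × ℂ => dilationIntegrand γ f q p.1 p.2)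
      (f := fun p : ℝ × ℂ => ((p.1 : ℂ), p.2)) (continuous_dilationIntegrand γ f q) (by fun_prop)
  exact continuous_parametric_integral_of_continuous hc (isCompact_closedBall 0 N)

/-- On a fixed disc the limit is continuity on a compact set; outside it the pairings are small
uniformly in `r ≥ 1 / 2`. -/
theorem tendsto_dilationPairing (γ : ℂ) (f q : FockSpace) :
    Tendsto (fun r : ℝ => dilationPairing γ f q r) (𝓝[<] 1) (𝓝 (Real.pi * inner ℂ q f)) := by
  have hπ : (Real.pi * inner ℂ q f : ℂ) = dilationPairing γ f q (1 : ℝ) := by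
    have : (Real.pi : ℂ) ≠ 0 := by exact_mod_cast Real.pi_ne_zero
    rw [inner_def, dilationPairing, Complex.ofReal_one, funext (dilationIntegrand_one γ f q)]
    push_cast
    rw [← mul_assoc, mul_one_div_cancel this, one_mul]
  rw [hπ, Metric.tendsto_nhds]
  intro ε hε
  set K := 4 * Real.exp (‖γ‖ ^ 2) * ∫ z, ‖f z‖ ^ 2 * Real.exp (-‖z‖ ^ 2)
  have hK0 : 0 ≤ K := mul_nonneg (by positivity) (integral_nonneg fun z => by positivity)
  -- First `δ` makes the `f` part of the tail at most `ε / 8`, then `N` does the same for the `q`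
  -- part.
  set δ := ε / (8 * (K + 1)) with hδ
  have hδ0 : 0 < δ := by positivity
  have hδK : δ * K ≤ ε / 8 := by
    rw [hδ, div_mul_eq_mul_div, div_le_div_iff₀ (by positivity) (by norm_num)]
    nlinarith
  obtain ⟨N, hN⟩ : ∃ N : ℝ, δ⁻¹ * ∫ w in (Metric.closedBall (0 : ℂ) N)ᶜ,
      ‖q w‖ ^ 2 * Real.exp (-‖w‖ ^ 2) < ε / 8 := by
    have h := (aecover_closedBall (μ := (volume : Measure ℂ)) (x := 0) (tendsto_id
      (α := ℝ) (x := atTop))).integral_tendsto_of_countably_generated q.integrable_sq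
    obtain ⟨N, hN⟩ := ((Metric.tendsto_nhds.1 h) (δ * (ε / 8)) (by positivity)).exists
    refine ⟨N, ?_⟩
    rw [inv_mul_lt_iff₀ hδ0]
    have hsplit := integral_add_compl (μ := (volume : Measure ℂ))
      (Metric.isClosed_closedBall (x := (0 : ℂ)) (ε := N)).measurableSet q.integrable_sq
    rw [Real.dist_eq, abs_lt] at hN
    simp only [id] at hN
    linarith [hN.1]
  have hev := Metric.tendsto_nhds.1 (tendsto_setIntegral_dilationIntegrand γ f q N) (ε / 2)
    (by positivity)
  filter_upwards [hev, Ioo_mem_nhdsLT (by norm_num : (1 / 2 : ℝ) < 1)] with r hr hr1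
  have hsplit : ∀ r : ℝ, 1 / 2 ≤ r → r ≤ 1 → dilationPairing γ f q r =
      (∫ w in Metric.closedBall 0 N, dilationIntegrand γ f q r w) +
      ∫ w in (Metric.closedBall 0 N)ᶜ, dilationIntegrand γ f q r w := fun r h0 h1 =>
    (integral_add_compl Metric.isClosed_closedBall.measurableSet
      (integrable_dilationIntegrand_ofReal γ f q (by linarith) h1)).symm
  have ht : ∀ r : ℝ, 1 / 2 ≤ r → r ≤ 1 →
      ‖∫ w in (Metric.closedBall 0 N)ᶜ, dilationIntegrand γ f q r w‖ < ε / 4 := fun r h0 h1 => by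
    have := norm_setIntegral_dilationIntegrand_le γ f q h0 h1 hδ0 (Metric.closedBall 0 N)ᶜ
    linarith
  rw [hsplit r hr1.1.le hr1.2.le, hsplit 1 (by norm_num) le_rfl, dist_eq_norm, add_sub_add_comm]
  rw [dist_eq_norm] at hr
  have h1 := ht r hr1.1.le hr1.2.le
  have h2 := ht 1 (by norm_num) le_rfl
  refine (norm_add_le _ _).trans_lt ?_
  linarith [norm_sub_le (∫ w in (Metric.closedBall 0 N)ᶜ, dilationIntegrand γ f q r w)
    (∫ w in (Metric.closedBall 0 N)ᶜ, dilationIntegrand γ f q (1 : ℝ) w)]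

/-- The maximal operator `g ↦ C wᵐ exp (γ̄ w) g⁽ᵐ⁾(α w + γ)` with `α`, `C` real is symmetric. -/
theorem inner_eq_of_weightedComp (m : ℕ) (γ : ℂ) (α C : ℝ) {f g p q : FockSpace}
    (hf : ∀ w, f w = C * (w ^ m * Complex.exp (conj γ * w) * iteratedDeriv m g (α * w + γ)))
    (hp : ∀ w, p w = C * (w ^ m * Complex.exp (conj γ * w) * iteratedDeriv m q (α * w + γ))) :
    (inner ℂ q f : ℂ) = inner ℂ p g := by
  -- The factor `exp ((1 - r) γ̄ w)` restores `exp (γ̄ w)` after dilation, so only `α` changes,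
  -- apart from `rᵐ`.
  have hrep : ∀ {f g : FockSpace}, (∀ w, f w =
      C * (w ^ m * Complex.exp (conj γ * w) * iteratedDeriv m g (α * w + γ))) →
      ∀ (h : FockSpace) (r : ℝ) (w : ℂ), dilationIntegrand γ f h r w = C * r ^ m *
        (w ^ m * Complex.exp (conj γ * w) * iteratedDeriv m g ((α * r : ℝ) * w + γ) * conj (h w) *
        (Real.exp (-‖w‖ ^ 2) : ℂ)) := by
    intro f g hfg h r w
    have he : Complex.exp (conj γ * w) =
        Complex.exp (conj γ * (1 - r) * w) * Complex.exp (conj γ * (r * w)) := by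
      rw [← Complex.exp_add]
      ring_nf
    rw [dilationIntegrand, hfg, he, Complex.ofReal_mul, mul_assoc (α : ℂ), mul_pow]
    ring
  -- Conjugating a real `r` changes nothing, but it makes the right side holomorphic in `r`.
  have hsmall : ∀ r : ℝ, |α * r| < 1 →
      dilationPairing γ f q r = conj (dilationPairing γ p g (conj (r : ℂ))) := by
    intro r hr
    rw [Complex.conj_ofReal, dilationPairing, dilationPairing, funext (hrep hf q r),
      funext (hrep hp g r), integral_const_mul, integral_const_mul,
      integral_weightedComp_symm m γ hr, map_mul, ← integral_conj]
    simp only [map_mul, map_pow, Complex.conj_ofReal]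
  have hG := differentiableOn_dilationPairing γ f q
  have hH : DifferentiableOn ℂ (fun r => conj (dilationPairing γ p g (conj r)))
      (Metric.ball 0 1) := by
    intro r hr
    have hr' : conj r ∈ Metric.ball (0 : ℂ) 1 := by
      rwa [mem_ball_zero_iff, RCLike.norm_conj, ← mem_ball_zero_iff]
    have := ((differentiableOn_dilationPairing γ p g).differentiableAt
      (Metric.isOpen_ball.mem_nhds hr')).hasDerivAt.conj_conj
    rw [Complex.conj_conj] at this
    exact this.differentiableAt.differentiableWithinAt
  have hfreq : ∃ᶠ r in 𝓝[≠] (0 : ℂ),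
      dilationPairing γ f q r = conj (dilationPairing γ p g (conj r)) := by
    have ht : Tendsto (fun r : ℝ => (r : ℂ)) (𝓝[≠] 0) (𝓝[≠] (0 : ℂ)) := by
      refine tendsto_nhdsWithin_iff.2 ⟨?_, ?_⟩
      · exact (Complex.continuous_ofReal.tendsto' 0 0 Complex.ofReal_zero).mono_left
          nhdsWithin_le_nhds
      · filter_upwards [self_mem_nhdsWithin] with r hr
        simpa using hr
    have hev : ∀ᶠ r : ℝ in 𝓝[≠] 0, |α * r| < 1 := by
      have : Tendsto (fun r : ℝ => |α * r|) (𝓝 0) (𝓝 0) :=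
        (by fun_prop : Continuous fun r : ℝ => |α * r|).tendsto' 0 0 (by simp)
      exact (this.eventually (gt_mem_nhds one_pos)).filter_mono nhdsWithin_le_nhds
    exact ht.frequently (hev.mono hsmall).frequently
  -- Agreement at real points accumulating at `0` spreads to the whole disc, whatever the size of
  -- `α`.
  have heq := (hG.analyticOnNhd Metric.isOpen_ball).eqOn_of_preconnected_of_frequently_eq
    (hH.analyticOnNhd Metric.isOpen_ball) (convex_ball 0 1).isPreconnected
    (Metric.mem_ball_self one_pos) hfreq
  have hlim := (Complex.continuous_conj.tendsto _).comp (tendsto_dilationPairing γ p g)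
  have hlim' : Tendsto (fun r : ℝ => dilationPairing γ f q r) (𝓝[<] 1)
      (𝓝 (conj (Real.pi * inner ℂ g p))) := by
    refine hlim.congr' ?_
    filter_upwards [Ioo_mem_nhdsLT (by norm_num : (0 : ℝ) < 1)] with r hr
    have : (r : ℂ) ∈ Metric.ball (0 : ℂ) 1 := by
      rw [mem_ball_zero_iff, Complex.norm_real, Real.norm_of_nonneg hr.1.le]
      exact hr.2
    simp only [heq this, Complex.conj_ofReal, Function.comp_apply]
  have h := tendsto_nhds_unique (tendsto_dilationPairing γ f q) hlim'
  rw [map_mul, Complex.conj_ofReal, inner_conj_symm] at h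
  exact mul_left_cancel₀ (by exact_mod_cast Real.pi_ne_zero) h

end FockSpace

/-! ### Kernel pairs and the adjoint -/

open ComplexConjugate FockSpace

theorem mem_maxWeightedComp {m : ℕ} {ψ φ χ : ℂ → ℂ} {f g : FockSpace} :
    (f, g) ∈ maxWeightedComp m ψ φ χ ↔ ∀ z, ψ z * f (φ z) = χ z * iteratedDeriv m g z :=
  Iff.rfl

theorem kernel_mem_relAdjoint (m : ℕ) (ψ φ χ : ℂ → ℂ) (z : ℂ) :
    (conj (χ z) • kernel m z, conj (ψ z) • kernel 0 (φ z)) ∈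
      relAdjoint (maxWeightedComp m ψ φ χ) := by
  rw [mem_relAdjoint]
  intro f g hfg
  rw [inner_smul_left, inner_smul_left, Complex.conj_conj, Complex.conj_conj, inner_kernel,
    inner_kernel_zero, mem_maxWeightedComp.1 hfg]

/-- Pairing an element of the adjoint with the kernel pair at `z` is its defining equation at `z`,
up to conjugation. -/
theorem relAdjoint_maxWeightedComp_le {m : ℕ} {ψ φ χ : ℂ → ℂ}
    (h : ∀ z, (conj (χ z) • kernel m z, conj (ψ z) • kernel 0 (φ z)) ∈ maxWeightedComp m ψ φ χ) :
    relAdjoint (maxWeightedComp m ψ φ χ) ≤ maxWeightedComp m ψ φ χ := by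
  rintro ⟨u, v⟩ huv
  rw [mem_relAdjoint] at huv
  refine mem_maxWeightedComp.2 fun z => ?_
  have := congrArg conj (huv _ _ (h z))
  rwa [inner_conj_symm, inner_conj_symm, inner_smul_left, inner_smul_left, Complex.conj_conj,
    Complex.conj_conj, inner_kernel_zero, inner_kernel] at this

theorem iteratedDeriv_smul_kernel_zero (m : ℕ) (c a w : ℂ) :
    iteratedDeriv m (c • kernel 0 a : FockSpace) w =
      c * (conj a ^ m * Complex.exp (conj a * w)) := by
  have h : ((c • kernel 0 a : FockSpace) : ℂ → ℂ) = c • fun u => Complex.exp (conj a * u) := by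
    funext u
    simp [kernel_apply, mul_comm]
  rw [h, iteratedDeriv_const_smul_field, iteratedDeriv_cexp_const_mul]
  rfl

theorem kernel_mem_maxWeightedComp_iff {m : ℕ} {ψ φ χ : ℂ → ℂ} {z : ℂ} :
    (conj (χ z) • kernel m z, conj (ψ z) • kernel 0 (φ z)) ∈ maxWeightedComp m ψ φ χ ↔
      ∀ w, ψ w * (conj (χ z) * (φ w ^ m * Complex.exp (φ w * conj z))) =
        χ w * (conj (ψ z) * (conj (φ z) ^ m * Complex.exp (conj (φ z) * w))) := by
  rw [mem_maxWeightedComp]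
  simp only [iteratedDeriv_smul_kernel_zero, FockSpace.smul_apply, kernel_apply]

/-! ### Solving the kernel identity -/

theorem eq_of_exp_eq_const {F : ℂ → ℂ} (hF : Differentiable ℂ F) {k : ℂ}
    (h : ∀ z, Complex.exp (F z) = k) (z : ℂ) : F z = F 0 := by
  refine is_const_of_deriv_eq_zero hF (fun w => ?_) z 0
  have h1 := (hF w).hasDerivAt.cexp
  rw [funext h] at h1
  have h2 := h1.unique (hasDerivAt_const w k)
  exact (mul_eq_zero.1 h2).resolve_left (Complex.exp_ne_zero _)

theorem dense_ne_zero_of_differentiable {F : ℂ → ℂ} (hF : Differentiable ℂ F) {z₀ : ℂ}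
    (h : F z₀ ≠ 0) : Dense {z | F z ≠ 0} := by
  intro x
  by_contra hx
  rw [mem_closure_iff_frequently, Filter.not_frequently] at hx
  refine h ?_
  have h0 : F = fun _ => 0 :=
    (show AnalyticOnNhd ℂ F Set.univ from fun z _ => hF.analyticAt z).eq_of_eventuallyEq
      (analyticOnNhd_const (v := (0 : ℂ))) (z₀ := x) (hx.mono fun z hz => by simpa using hz)
  rw [h0]

/-- Supplies a base point away from `0`, since the slope of `φ` is read off as a difference quotient
between `0` and this point. -/
theorem exists_ne_zero_pow_ne_zero {m : ℕ} {φ : ℂ → ℂ} (hφ : Differentiable ℂ φ)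
    (hconst : m = 0 ∨ ∃ z w : ℂ, φ z ≠ φ w) : ∃ z, z ≠ 0 ∧ φ z ^ m ≠ 0 := by
  rcases hconst with rfl | ⟨z, w, hzw⟩
  · exact ⟨1, one_ne_zero, by simp⟩
  · by_contra! h
    have h0 : φ = fun _ => 0 := hφ.continuous.ext_on (dense_compl_singleton (0 : ℂ))
      continuous_const fun z hz => eq_zero_of_pow_eq_zero (h z hz)
    exact hzw (by rw [h0])

theorem hasHermitianForm_of_kernel_identity {m : ℕ} {ψ φ χ : ℂ → ℂ} (hφ : Differentiable ℂ φ)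
    (hψ0 : ∀ z : ℂ, ψ z ≠ 0) (hχ0 : χ ≠ 0) (hconst : m = 0 ∨ ∃ z w : ℂ, φ z ≠ φ w)
    (h : ∀ z w, ψ w * (conj (χ z) * (φ w ^ m * Complex.exp (φ w * conj z))) =
        χ w * (conj (ψ z) * (conj (φ z) ^ m * Complex.exp (conj (φ z) * w)))) :
    HasHermitianForm m ψ φ χ := by
  obtain ⟨z₀, hz₀, hφz₀⟩ := exists_ne_zero_pow_ne_zero hφ hconst
  obtain ⟨w₀, hw₀⟩ := Function.ne_iff.1 hχ0
  have hz₀' : conj z₀ ≠ 0 := (map_ne_zero _).2 hz₀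
  have hψc : ∀ z, conj (ψ z) ≠ 0 := fun z => (map_ne_zero _).2 (hψ0 z)
  have hφc : conj (φ z₀) ^ m ≠ 0 := by
    rw [← map_pow]
    exact (map_ne_zero _).2 hφz₀
  have hχz₀ : χ z₀ ≠ 0 := by
    intro h0
    have := h z₀ w₀
    rw [h0, map_zero, zero_mul, mul_zero] at this
    exact mul_ne_zero hw₀ (mul_ne_zero (hψc z₀) (mul_ne_zero hφc (Complex.exp_ne_zero _))) this.symm
  -- Freezing `z = z₀` determines `χ / ψ` in terms of `φ`.
  obtain ⟨c, hc0, hc⟩ : ∃ c : ℂ, c ≠ 0 ∧ ∀ w, χ w = ψ w * (c * (φ w ^ m *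
      Complex.exp (φ w * conj z₀ - conj (φ z₀) * w))) := by
    refine ⟨conj (χ z₀) / (conj (ψ z₀) * conj (φ z₀) ^ m),
      div_ne_zero ((map_ne_zero _).2 hχz₀) (mul_ne_zero (hψc z₀) hφc), fun w => ?_⟩
    have h1 := h z₀ w
    have h2 := Complex.exp_ne_zero (conj (φ z₀) * w)
    have h3 := hψc z₀
    rw [Complex.exp_sub]
    field_simp
    linear_combination -h1
  -- Substituting back, the powers of `φ` cancel on a dense set, and continuity gives the
  -- exponential identity everywhere.
  have hstar : ∀ p : ℂ × ℂ, conj c * Complex.exp (conj (φ p.1) * z₀ - φ z₀ * conj p.1 +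
      φ p.2 * conj p.1) = c * Complex.exp (φ p.2 * conj z₀ - conj (φ z₀) * p.2 +
        conj (φ p.1) * p.2) := by
    have hd := dense_ne_zero_of_differentiable (hφ.pow m) hφz₀
    have hφ' := hφ.continuous
    have hconj : Continuous fun w : ℂ => conj w := Complex.continuous_conj
    refine congrFun (Continuous.ext_on (hd.prod hd) (by fun_prop) (by fun_prop) ?_)
    rintro ⟨z, w⟩ ⟨hz, hw⟩
    have hz' : conj (φ z) ^ m ≠ 0 := by
      rw [← map_pow]
      exact (map_ne_zero _).2 hz
    have h1 := h z w
    rw [hc z, hc w] at h1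
    simp only [map_mul, map_pow, map_sub, ← Complex.exp_conj, Complex.conj_conj] at h1
    refine mul_left_cancel₀ (mul_ne_zero (mul_ne_zero (hψ0 w) (hψc z))
      (mul_ne_zero (show φ w ^ m ≠ 0 from hw) hz')) ?_
    simp only [Complex.exp_add]
    linear_combination h1
  set B := φ 0
  have hzero : ∀ z, c * Complex.exp (φ z * conj z₀ - conj (φ z₀) * z + conj B * z) =
      conj c * Complex.exp (conj B * z₀) := by
    intro z
    have h1 := congrArg conj (hstar (z, 0))
    simp only [map_mul, map_sub, map_add, ← Complex.exp_conj, Complex.conj_conj, mul_zero, sub_zero,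
      add_zero] at h1
    rw [← h1]
  -- An entire function with constant exponential is constant; its value is taken at `0`.
  have haff : ∀ z, φ z * conj z₀ - conj (φ z₀) * z + conj B * z = B * conj z₀ := by
    intro z
    have := eq_of_exp_eq_const
      (F := fun z => φ z * conj z₀ - conj (φ z₀) * z + conj B * z) (by fun_prop)
      (k := conj c * Complex.exp (conj B * z₀) / c) (fun z => by
        rw [eq_div_iff hc0, ← hzero z, mul_comm]) z
    simpa using this
  -- Reality of the slope is `haff` at `z₀`; reality of `d` below is `hzero` at `0`.
  obtain ⟨A, hA⟩ : ∃ A : ℝ, (A : ℂ) = (φ z₀ - B) / z₀ := by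
    refine Complex.conj_eq_iff_real.1 ?_ |>.imp fun _ h => h.symm
    rw [map_div₀, map_sub, div_eq_div_iff hz₀' hz₀]
    linear_combination -haff z₀
  obtain ⟨d, hd⟩ : ∃ d : ℝ, (d : ℂ) = c * Complex.exp (B * conj z₀) := by
    refine Complex.conj_eq_iff_real.1 ?_ |>.imp fun _ h => h.symm
    have h0 := hzero 0
    rw [haff 0] at h0
    rw [map_mul, ← Complex.exp_conj, map_mul, Complex.conj_conj, h0]
  have hφA : ∀ u, φ u = A * u + B := by
    intro u
    have hA' : (A : ℂ) * conj z₀ = conj (φ z₀) - conj B := by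
      rw [← Complex.conj_ofReal, hA, map_div₀, map_sub, div_mul_cancel₀ _ hz₀']
    refine mul_right_cancel₀ hz₀' ?_
    linear_combination haff u - u * hA'
  have hd0 : (d : ℂ) ≠ 0 := hd ▸ mul_ne_zero hc0 (Complex.exp_ne_zero _)
  refine ⟨A, d⁻¹, B, inv_ne_zero (by exact_mod_cast hd0), hφA, fun u => ?_⟩
  have h1 : φ u * conj z₀ - conj (φ z₀) * u = B * conj z₀ - u * conj B := by
    linear_combination haff u
  have h2 := Complex.exp_ne_zero (u * conj B)
  rw [hc u, h1, Complex.exp_sub, ← hφA]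
  push_cast
  rw [inv_mul_eq_div, div_mul_eq_mul_div, div_eq_iff hd0, hd]
  field_simp

/-! ### From the Hermitian form to self-adjointness -/

/-- As `A` is real, both sides share the factor `exp (A w z̄)`; the rest is the form at `w` combined
with its conjugate at `z`, where `C` is real. -/
theorem kernel_mem_maxWeightedComp_of_hasHermitianForm {m : ℕ} {ψ φ χ : ℂ → ℂ}
    (h : HasHermitianForm m ψ φ χ) (z : ℂ) :
    (conj (χ z) • kernel m z, conj (ψ z) • kernel 0 (φ z)) ∈ maxWeightedComp m ψ φ χ := by
  obtain ⟨A, C, B, hC, hφ, h⟩ := h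
  have hC' : (C : ℂ) ≠ 0 := by exact_mod_cast hC
  refine kernel_mem_maxWeightedComp_iff.2 fun w => ?_
  have hw := h w
  have hz := congrArg conj (h z)
  rw [hφ w, hφ z]
  simp only [map_mul, map_pow, map_add, ← Complex.exp_conj, Complex.conj_conj,
    Complex.conj_ofReal] at hz ⊢
  have e1 : Complex.exp ((A * w + B) * conj z) =
      Complex.exp (conj z * B) * Complex.exp (A * w * conj z) := by
    rw [← Complex.exp_add]
    ring_nf
  have e2 : Complex.exp ((A * conj z + conj B) * w) =
      Complex.exp (w * conj B) * Complex.exp (A * w * conj z) := by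
    rw [← Complex.exp_add]
    ring_nf
  rw [e1, e2]
  refine mul_left_cancel₀ hC' ?_
  linear_combination (ψ w * (A * w + B) ^ m * Complex.exp (A * w * conj z)) * hz -
    (conj (ψ z) * (A * conj z + conj B) ^ m * Complex.exp (A * w * conj z)) * hw

theorem maxWeightedComp_le_relAdjoint {m : ℕ} {ψ φ χ : ℂ → ℂ} (hψ0 : ∀ z : ℂ, ψ z ≠ 0)
    (hconst : m = 0 ∨ ∃ z w : ℂ, φ z ≠ φ w) (h : HasHermitianForm m ψ φ χ) :
    maxWeightedComp m ψ φ χ ≤ relAdjoint (maxWeightedComp m ψ φ χ) := by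
  obtain ⟨A, C, B, hC, hφ, h⟩ := h
  have hC' : (C : ℂ) ≠ 0 := by exact_mod_cast hC
  have hmem : ∀ {f g : FockSpace}, (f, g) ∈ maxWeightedComp m ψ φ χ → ∀ z,
      C * Complex.exp (z * conj B) * f (A * z + B) = (A * z + B) ^ m * iteratedDeriv m g z := by
    intro f g hfg z
    have h1 := mem_maxWeightedComp.1 hfg z
    rw [hφ] at h1
    refine mul_left_cancel₀ (hψ0 z) ?_
    linear_combination C * Complex.exp (z * conj B) * h1 + iteratedDeriv m g z * h z
  rintro ⟨u, v⟩ huv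
  rw [mem_relAdjoint]
  intro f g hfg
  -- For `m = 0` the relation is solved for `g`, which allows `A = 0`. Otherwise `A ≠ 0`, and it is
  -- solved for `f` through `z = (w - B) / A`.
  rcases hconst with rfl | ⟨z₁, z₂, hne⟩
  · have hT : ∀ {f g : FockSpace}, (f, g) ∈ maxWeightedComp 0 ψ φ χ → ∀ w, g w =
        C * (w ^ 0 * Complex.exp (conj B * w) * iteratedDeriv 0 f (A * w + B)) := by
      intro f g hfg w
      have := hmem hfg w
      rw [pow_zero, one_mul, iteratedDeriv_zero] at this ⊢
      rw [← this, mul_comm w]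
      ring
    exact inner_eq_of_weightedComp 0 B A C (hT hfg) (hT huv)
  · have hA : (A : ℂ) ≠ 0 := by
      intro hA
      exact hne (by rw [hφ, hφ, hA, zero_mul, zero_mul])
    have hT : ∀ {f g : FockSpace}, (f, g) ∈ maxWeightedComp m ψ φ χ → ∀ w, f w =
        ((Real.exp (‖B‖ ^ 2 / A) / C : ℝ) : ℂ) * (w ^ m * Complex.exp (conj (-B / A) * w) *
          iteratedDeriv m g ((A⁻¹ : ℝ) * w + -B / A)) := by
      intro f g hfg w
      have h1 := hmem hfg (((A⁻¹ : ℝ) * w + -B / A))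
      have h2 : (A : ℂ) * ((A⁻¹ : ℝ) * w + -B / A) + B = w := by
        push_cast
        field_simp
        ring
      -- With `γ = -B / A` the exponents `γ̄ w` and `z B̄` add up to `-‖B‖² / A`, which the real
      -- constant cancels.
      have h3 : ((Real.exp (‖B‖ ^ 2 / A) : ℝ) : ℂ) * Complex.exp (conj (-B / A) * w) *
          Complex.exp (((A⁻¹ : ℝ) * w + -B / A) * conj B) = 1 := by
        rw [Complex.ofReal_exp, ← Complex.exp_add, ← Complex.exp_add, ← Complex.exp_zero]
        congr 1
        push_cast
        rw [← Complex.mul_conj', map_div₀, map_neg, Complex.conj_ofReal]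
        field_simp
        ring
      rw [h2] at h1
      rw [Complex.ofReal_div, div_mul_eq_mul_div, eq_div_iff hC']
      linear_combination (-(f w * C)) * h3 +
        ((Real.exp (‖B‖ ^ 2 / A) : ℝ) : ℂ) * Complex.exp (conj (-B / A) * w) * h1
    exact (inner_eq_of_weightedComp m (-B / A) A⁻¹ _ (hT hfg) (hT huv)).symm

theorem HasHermitianForm.of_symbolsEquivalent {m : ℕ} {ψ φ χ ψ₁ χ₁ : ℂ → ℂ}
    (hψ0 : ∀ z : ℂ, ψ z ≠ 0) (hψ₁0 : ∀ z : ℂ, ψ₁ z ≠ 0) (he : SymbolsEquivalent ψ χ ψ₁ χ₁)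
    (h : HasHermitianForm m ψ₁ φ χ₁) : HasHermitianForm m ψ φ χ := by
  obtain ⟨A, C, B, hC, hφ, h⟩ := h
  refine ⟨A, C, B, hC, hφ, fun u => ?_⟩
  have h1 := (div_eq_div_iff (hψ0 u) (hψ₁0 u)).1 (he u)
  refine mul_left_cancel₀ (hψ₁0 u) ?_
  linear_combination C * Complex.exp (u * conj B) * h1 + ψ u * h u

theorem mainTheorem5 (m : ℕ) (ψ φ χ : ℂ → ℂ)
    (hψ : Differentiable ℂ ψ) (hφ : Differentiable ℂ φ) (hχ : Differentiable ℂ χ)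
    (hψ0 : ∀ z : ℂ, ψ z ≠ 0) (hχ0 : χ ≠ 0)
    (hconst : m = 0 ∨ ∃ z w : ℂ, φ z ≠ φ w) :
    [IsHermitianRel (maxWeightedComp m ψ φ χ),
      relAdjoint (maxWeightedComp m ψ φ χ) ≤ maxWeightedComp m ψ φ χ,
      ∃ ψ₁ χ₁ : ℂ → ℂ, Differentiable ℂ ψ₁ ∧ Differentiable ℂ χ₁ ∧ (∀ z : ℂ, ψ₁ z ≠ 0) ∧
        SymbolsEquivalent ψ χ ψ₁ χ₁ ∧ HasHermitianForm m ψ₁ φ χ₁].TFAE := by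
  tfae_have 1 → 2 := fun h => h.le
  tfae_have 2 → 3 := fun h => ⟨ψ, χ, hψ, hχ, hψ0, fun _ => rfl,
    hasHermitianForm_of_kernel_identity hφ hψ0 hχ0 hconst fun z =>
      kernel_mem_maxWeightedComp_iff.1 (h (kernel_mem_relAdjoint m ψ φ χ z))⟩
  tfae_have 3 → 1 := by
    rintro ⟨ψ₁, χ₁, -, -, hψ₁0, he, h⟩
    have h' := h.of_symbolsEquivalent hψ0 hψ₁0 he
    exact le_antisymm
      (relAdjoint_maxWeightedComp_le (kernel_mem_maxWeightedComp_of_hasHermitianForm h'))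
      (maxWeightedComp_le_relAdjoint hψ0 hconst h')
  tfae_finish
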